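/- Let $M$ be a smooth $n$-dimensional manifold (without boundary, not necessarily compact) with a smooth Riemannian metric $g$, Levi-Civita connection $\nabla$ and Ricci tensor $R_{ab}$, with the sign convention $[\nabla_a,\nabla_b]V^a=R_{ab}V^a$. Write $\Delta=\nabla^a\nabla_a$, $|K|^2=K^aK_a$ and $\nabla_{(a}K_{b)}=\tfrac12(\nabla_aK_b+\nabla_bK_a)$. Let $\lambda\in\mathbb R$, let $\Gamma:M\to\mathbb R$ be a smooth function with $\Gamma>0$ everywhere, and let $K$ be a smooth vector field on $M$ such that $$R_{ab}=\frac{K_aK_b}{2\Gamma^2}-\frac{(\nabla_a\Gamma)(\nabla_b\Gamma)}{2\Gamma^2}-\frac1\Gamma\nabla_{(a}K_{b)}+\frac1\Gamma\nabla_a\nabla_b\Gamma+\lambda g_{ab}$$ on $M$. (This is the horizon equation $R_{ab}=\tfrac12X_aX_b-\nabla_{(a}X_{b)}+\lambda g_{ab}$ for the vector field $X$ determined by $K_a=\Gamma X_a+\nabla_a\Gamma$.) Then the following identity holds on $M$: $$\nabla_{(a}K_{b)}\nabla^aK^b=\nabla^a\Big(K^b\nabla_{(a}K_{b)}-\tfrac12K_a\Delta\Gamma-\tfrac12K_a\nabla_bK^b-\lambda\Gamma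 K_a\Big)+\nabla_bK^b\Big(-\frac1{2\Gamma}|K|^2+\tfrac12\Delta\Gamma+\tfrac12\nabla_bK^b+\frac1{2\Gamma}K^b\nabla_b\Gamma+\lambda\Gamma\Big).$$ -/

import Mathlib

open scoped Manifold ContDiff

namespace HorizonIdentity

noncomputable section

/-! Tensor calculus in a coordinate patch of `ℝⁿ`. A tensor field is given by its components, which
are functions of the coordinates `u`; the first slot of a covariant derivative is the derivative
index. The metric is `G : ℝⁿ → Matrix`, with components `G u a b`. -/

section Coordinates

variable {n : ℕ}

/-- The coordinate partial derivative `∂_a f` at `u`. -/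
def pd (a : Fin n) (f : EuclideanSpace ℝ (Fin n) → ℝ) (u : EuclideanSpace ℝ (Fin n)) : ℝ :=
  fderiv ℝ f u (EuclideanSpace.single a 1)

/-- The Christoffel symbols of the Levi-Civita connection,
`Γ^c_{ab} = ½ g^{cd} (∂_a g_{db} + ∂_b g_{da} - ∂_d g_{ab})`. -/
def christoffel (G : EuclideanSpace ℝ (Fin n) → Matrix (Fin n) (Fin n) ℝ) (c a b : Fin n)
    (u : EuclideanSpace ℝ (Fin n)) : ℝ :=
  (1 / 2 : ℝ) * ∑ d, (G u)⁻¹ c d *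
    (pd a (fun v => G v d b) u + pd b (fun v => G v d a) u - pd d (fun v => G v a b) u)

/-- The Riemann tensor
`R^d_{cab} = ∂_a Γ^d_{bc} - ∂_b Γ^d_{ac} + Γ^d_{ae} Γ^e_{bc} - Γ^d_{be} Γ^e_{ac}`,
so that `[∇_a, ∇_b] V^d = R^d_{cab} V^c`. -/
def riemann (G : EuclideanSpace ℝ (Fin n) → Matrix (Fin n) (Fin n) ℝ) (d c a b : Fin n)
    (u : EuclideanSpace ℝ (Fin n)) : ℝ :=
  pd a (christoffel G d b c) u - pd b (christoffel G d a c) u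
    + ∑ e, (christoffel G d a e u * christoffel G e b c u
      - christoffel G d b e u * christoffel G e a c u)

/-- The Ricci tensor `R_{ab} = R^c_{acb}`. -/
def ricci (G : EuclideanSpace ℝ (Fin n) → Matrix (Fin n) (Fin n) ℝ) (a b : Fin n)
    (u : EuclideanSpace ℝ (Fin n)) : ℝ :=
  ∑ c, riemann G c a c b u

/-- The covariant derivative of a one-form, `∇_a θ_b = ∂_a θ_b - Γ^c_{ab} θ_c`. -/
def covDeriv (G : EuclideanSpace ℝ (Fin n) → Matrix (Fin n) (Fin n) ℝ)
    (θ : Fin n → EuclideanSpace ℝ (Fin n) → ℝ) (a b : Fin n)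
    (u : EuclideanSpace ℝ (Fin n)) : ℝ :=
  pd a (θ b) u - ∑ c, christoffel G c a b u * θ c u

/-- The symmetrized covariant derivative `∇_{(a} θ_{b)} = ½ (∇_a θ_b + ∇_b θ_a)`. -/
def symCovDeriv (G : EuclideanSpace ℝ (Fin n) → Matrix (Fin n) (Fin n) ℝ)
    (θ : Fin n → EuclideanSpace ℝ (Fin n) → ℝ) (a b : Fin n)
    (u : EuclideanSpace ℝ (Fin n)) : ℝ :=
  (1 / 2 : ℝ) * (covDeriv G θ a b u + covDeriv G θ b a u)

/-- The divergence `∇^a θ_a = g^{ab} ∇_a θ_b`. -/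
def divergence (G : EuclideanSpace ℝ (Fin n) → Matrix (Fin n) (Fin n) ℝ)
    (θ : Fin n → EuclideanSpace ℝ (Fin n) → ℝ) (u : EuclideanSpace ℝ (Fin n)) : ℝ :=
  ∑ a, ∑ b, (G u)⁻¹ a b * covDeriv G θ a b u

/-- The differential `(df)_a = ∇_a f = ∂_a f`. -/
def grad (f : EuclideanSpace ℝ (Fin n) → ℝ) (a : Fin n) (u : EuclideanSpace ℝ (Fin n)) : ℝ :=
  pd a f u

/-- The Hessian `∇_a ∇_b f`. -/
def hessian (G : EuclideanSpace ℝ (Fin n) → Matrix (Fin n) (Fin n) ℝ)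
    (f : EuclideanSpace ℝ (Fin n) → ℝ) (a b : Fin n) (u : EuclideanSpace ℝ (Fin n)) : ℝ :=
  covDeriv G (grad f) a b u

/-- The Laplacian `Δ f = ∇^a ∇_a f`. -/
def laplacian (G : EuclideanSpace ℝ (Fin n) → Matrix (Fin n) (Fin n) ℝ)
    (f : EuclideanSpace ℝ (Fin n) → ℝ) (u : EuclideanSpace ℝ (Fin n)) : ℝ :=
  divergence G (grad f) u

/-- The pairing of one-forms `g^{ab} θ_a η_b`. -/
def pairing (G : EuclideanSpace ℝ (Fin n) → Matrix (Fin n) (Fin n) ℝ)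
    (θ η : Fin n → EuclideanSpace ℝ (Fin n) → ℝ) (u : EuclideanSpace ℝ (Fin n)) : ℝ :=
  ∑ a, ∑ b, (G u)⁻¹ a b * θ a u * η b u

/-- The one-form `K^b ∇_{(a} K_{b)}`. -/
def symCovDerivContract (G : EuclideanSpace ℝ (Fin n) → Matrix (Fin n) (Fin n) ℝ)
    (K : Fin n → EuclideanSpace ℝ (Fin n) → ℝ) (a : Fin n)
    (u : EuclideanSpace ℝ (Fin n)) : ℝ :=
  ∑ b, ∑ c, (G u)⁻¹ b c * K c u * symCovDeriv G K a b u

/-- The scalar `∇_{(a} K_{b)} ∇^a K^b`. -/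
def symCovDerivSq (G : EuclideanSpace ℝ (Fin n) → Matrix (Fin n) (Fin n) ℝ)
    (K : Fin n → EuclideanSpace ℝ (Fin n) → ℝ) (u : EuclideanSpace ℝ (Fin n)) : ℝ :=
  ∑ a, ∑ b, ∑ c, ∑ d, (G u)⁻¹ a c * (G u)⁻¹ b d * symCovDeriv G K a b u * covDeriv G K c d u

/-- The horizon equation at the point with coordinates `u`, in terms of `K_a` and `f > 0`:
`R_{ab} = K_a K_b / (2 f²) - (∇_a f)(∇_b f) / (2 f²) - ∇_{(a} K_{b)} / f + ∇_a ∇_b f / f + λ g_{ab}`.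
It is `R_{ab} = ½ X_a X_b - ∇_{(a} X_{b)} + λ g_{ab}` with `X_a = (K_a - ∇_a f) / f`. -/
def HorizonEquationAt (G : EuclideanSpace ℝ (Fin n) → Matrix (Fin n) (Fin n) ℝ)
    (K : Fin n → EuclideanSpace ℝ (Fin n) → ℝ) (f : EuclideanSpace ℝ (Fin n) → ℝ) (lam : ℝ)
    (u : EuclideanSpace ℝ (Fin n)) : Prop :=
  ∀ a b : Fin n, ricci G a b u =
    K a u * K b u / (2 * f u ^ 2) - grad f a u * grad f b u / (2 * f u ^ 2)
      - 1 / f u * symCovDeriv G K a b u + 1 / f u * hessian G f a b u + lam * G u a b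

end Coordinates

section Manifold

variable {n : ℕ} {M : Type*} [TopologicalSpace M] [ChartedSpace (EuclideanSpace ℝ (Fin n)) M]

/-- The coordinate vector field `∂_a` of the chart `φ`, at the point with coordinates `u`. -/
def coordVec (φ : OpenPartialHomeomorph M (EuclideanSpace ℝ (Fin n))) (a : Fin n)
    (u : EuclideanSpace ℝ (Fin n)) : TangentSpace (𝓡 n) (φ.symm u) :=
  mfderiv (𝓡 n) (𝓡 n) φ.symm u (EuclideanSpace.single a (1 : ℝ) : EuclideanSpace ℝ (Fin n))

variable [IsManifold (𝓡 n) ∞ M]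

/-- The components `g_{ab} = g(∂_a, ∂_b)` of the metric in the chart `φ`. -/
def metricComp
    (g : Bundle.ContMDiffRiemannianMetric (𝓡 n) ∞ (EuclideanSpace ℝ (Fin n))
      (TangentSpace (𝓡 n) : M → Type _))
    (φ : OpenPartialHomeomorph M (EuclideanSpace ℝ (Fin n)))
    (u : EuclideanSpace ℝ (Fin n)) : Matrix (Fin n) (Fin n) ℝ :=
  Matrix.of fun a b => g.inner (φ.symm u) (coordVec φ a u) (coordVec φ b u)

/-- The components `K_a = g(K, ∂_a)` in the chart `φ` of the one-form dual to a vector field. -/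
def lowerComp
    (g : Bundle.ContMDiffRiemannianMetric (𝓡 n) ∞ (EuclideanSpace ℝ (Fin n))
      (TangentSpace (𝓡 n) : M → Type _))
    (K : ∀ x : M, TangentSpace (𝓡 n) x)
    (φ : OpenPartialHomeomorph M (EuclideanSpace ℝ (Fin n))) (a : Fin n)
    (u : EuclideanSpace ℝ (Fin n)) : ℝ :=
  g.inner (φ.symm u) (K (φ.symm u)) (coordVec φ a u)

end Manifold

end

end HorizonIdentity

/-!
The identity is local, so it is proved in one chart, for the components of `g`, `K` and `Γ` on the
open set `U = φ.target ⊆ ℝⁿ`. There it becomes pure algebra: the smooth functions on `U` form a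
commutative ring with `n` commuting derivations `∂_a`, the metric is an invertible symmetric matrix
over that ring, and the tensor calculus needed is a calculus of matrices over it (`MetricRing`).

With `S = ∇_{(a}K_{b)}`, `d = ∇^a K_a` and `f = Γ`, multiply the horizon equation by `f`:
`f R_{ab} = K_a K_b / (2f) - ∇_a f ∇_b f / (2f) - S_{ab} + ∇_a ∇_b f + λ f g_{ab}`.
Take the divergence of this equation and, separately, the gradient of its trace. The contracted
Bianchi identity `∇^a R_{ab} = ½ ∇_b R` (`two_mul_div2_Ric`) and the commutation formula
`∇^a ∇_a ∇_b f = ∇_b Δf + R_{ab} ∇^a f` (`div2_hess`) allow all curvature to be eliminated, and what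
remains is a formula for `∇^a S_{ab}` in terms of `K` and `f` (`div2_sym1_of_horizon`). Contracted
with `K^b` it reads
`K^b ∇^a S_{ab} = d |K|² / (2f) + ½ K·∇Δf + λ K·∇f + ½ K·∇d - d K·∇f / (2f)`,
because `K^a K^b ∇_a K_b` cancels and so do the two terms in `|K|² K·∇f`. Adding the product rule
`∇^a (K^b S_{ab}) = S_{ab} ∇^a K^b + K^b ∇^a S_{ab}` (`tr_cov1_mulVec_sharp`) gives the identity.

The Bianchi identity is obtained by regarding the Christoffel symbols as matrices
`(A_a)^c_b = Γ^c_{ab}`. The curvature is `F_{ab} = ∂_a A_b - ∂_b A_a + [A_a, A_b]`, the differential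
Bianchi identity is the Jacobi identity for `∂_a + A_a` (`endD_cyclic`), and metric compatibility
`∂_a g = A_aᵀ g + g A_a` makes `F_{ab} g⁻¹` skew (`F_skew`).
-/

namespace HorizonIdentity

noncomputable section

/-! ### Matrices over a ring with commuting derivations -/

/-- A commutative ring `R` (functions) with commuting derivations `D a` (partial derivatives),
a symmetric matrix `G` over `R` (the metric) and its inverse `H`. -/
structure MetricRing (R : Type*) [CommRing R] [Algebra ℝ R] (ι : Type*) [Fintype ι]
    [DecidableEq ι] where
  D : ι → Derivation ℝ R R
  comm : ∀ a b x, D a (D b x) = D b (D a x)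
  G : Matrix ι ι R
  H : Matrix ι ι R
  symm : ∀ a b, G a b = G b a
  mul_eq_one : H * G = 1

namespace MetricRing

open Matrix

variable {R : Type*} [CommRing R] [Algebra ℝ R] {ι : Type*} [Fintype ι] [DecidableEq ι]
  (m : MetricRing R ι)

/-- The constant `1 / 2`. -/
def half (R : Type*) [CommRing R] [Algebra ℝ R] : R := algebraMap ℝ R (1 / 2)

lemma two_mul_half : 2 * half R = 1 := by
  have : (2 : R) = algebraMap ℝ R 2 := (map_ofNat _ 2).symm
  rw [half, this, ← map_mul, mul_one_div_cancel two_ne_zero, map_one]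

@[simp] lemma D_half (a : ι) : m.D a (half R) = 0 := Derivation.map_algebraMap _ _

lemma D_mul (a : ι) (x y : R) : m.D a (x * y) = m.D a x * y + x * m.D a y := by
  rw [Derivation.leibniz, smul_eq_mul, smul_eq_mul]; ring

/-- Entrywise partial derivative of a matrix. -/
def mD (a : ι) (T : Matrix ι ι R) : Matrix ι ι R := T.map (m.D a)

lemma mD_apply (a : ι) (T : Matrix ι ι R) (i j : ι) : m.mD a T i j = m.D a (T i j) := rfl

lemma mD_mul (a : ι) (S T : Matrix ι ι R) : m.mD a (S * T) = m.mD a S * T + S * m.mD a T := by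
  ext i j
  simp only [mD_apply, Matrix.mul_apply, Matrix.add_apply, map_sum, D_mul, Finset.sum_add_distrib]

lemma mD_add (a : ι) (S T : Matrix ι ι R) : m.mD a (S + T) = m.mD a S + m.mD a T := by
  ext; simp [mD_apply]

lemma mD_sub (a : ι) (S T : Matrix ι ι R) : m.mD a (S - T) = m.mD a S - m.mD a T := by
  ext; simp [mD_apply]

lemma mD_neg (a : ι) (T : Matrix ι ι R) : m.mD a (-T) = -m.mD a T := by
  ext; simp [mD_apply]

lemma mD_transpose (a : ι) (T : Matrix ι ι R) : m.mD a Tᵀ = (m.mD a T)ᵀ := rfl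

lemma mD_comm (a b : ι) (T : Matrix ι ι R) : m.mD a (m.mD b T) = m.mD b (m.mD a T) := by
  ext; exact m.comm _ _ _

lemma mD_one (a : ι) : m.mD a 1 = 0 := by
  ext i j
  by_cases h : i = j <;> simp [mD_apply, h]

lemma G_transpose : m.Gᵀ = m.G := by ext; exact m.symm _ _

lemma G_mul_H : m.G * m.H = 1 := mul_eq_one_comm.mp m.mul_eq_one

lemma H_transpose : m.Hᵀ = m.H := by
  have h : m.Hᵀ * m.G = 1 := by
    have := congrArg transpose m.G_mul_H
    rwa [transpose_mul, G_transpose, transpose_one] at this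
  calc m.Hᵀ = m.Hᵀ * (m.G * m.H) := by rw [G_mul_H, mul_one]
    _ = m.H := by rw [← mul_assoc, h, one_mul]

lemma H_symm (a b : ι) : m.H a b = m.H b a := congrFun (congrFun m.H_transpose b) a

/-- `(A a) c b = Γ^c_{ab}`. -/
def A (a : ι) : Matrix ι ι R := fun c b =>
  half R * ∑ d, m.H c d * (m.D a (m.G d b) + m.D b (m.G d a) - m.D d (m.G a b))

lemma A_symm (a b c : ι) : m.A a c b = m.A b c a := by
  simp only [A, m.symm a b]
  congr 1
  exact Finset.sum_congr rfl fun d _ => by ring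

lemma G_mul_A (a c b : ι) : (m.G * m.A a) c b =
    half R * (m.D a (m.G c b) + m.D b (m.G c a) - m.D c (m.G a b)) := by
  have h : m.A a = half R • (m.H * Matrix.of fun d b =>
      m.D a (m.G d b) + m.D b (m.G d a) - m.D d (m.G a b)) := by
    ext; simp [A, Matrix.mul_apply]
  rw [h, Matrix.mul_smul, ← mul_assoc, G_mul_H, one_mul]
  simp

/-- Metric compatibility `∇ g = 0`. -/
lemma mD_G (a : ι) : m.mD a m.G = (m.A a)ᵀ * m.G + m.G * m.A a := by
  have h : (m.A a)ᵀ * m.G = (m.G * m.A a)ᵀ := by rw [transpose_mul, G_transpose]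
  ext c b
  rw [h, Matrix.add_apply, transpose_apply, G_mul_A, G_mul_A, mD_apply, m.symm b c, m.symm b a,
    m.symm c a]
  linear_combination (-m.D a (m.G c b)) * two_mul_half (R := R)

/-- Metric compatibility `∇ g⁻¹ = 0`. -/
lemma mD_H (a : ι) : m.mD a m.H = -(m.A a * m.H) - m.H * (m.A a)ᵀ := by
  have h := congrArg (m.mD a) m.mul_eq_one
  rw [mD_mul, mD_one, mD_G, mul_add, ← mul_assoc m.H m.G, m.mul_eq_one, one_mul] at h
  have h2 := congrArg (· * m.H) h
  simp only [add_mul, zero_mul, mul_assoc, G_mul_H, mul_one] at h2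
  rw [← sub_eq_zero, ← h2]; abel

/-! ### Curvature -/

/-- The curvature, as a matrix: `(F a b) d c = R^d_{cab}`. -/
def F (a b : ι) : Matrix ι ι R :=
  m.mD a (m.A b) - m.mD b (m.A a) + (m.A a * m.A b - m.A b * m.A a)

lemma F_anti (a b : ι) : m.F a b = -m.F b a := by simp only [F]; abel

/-- The Ricci tensor `Ric e b = R^c_{ecb}`. -/
def Ric : Matrix ι ι R := fun e b => ∑ c, m.F c b c e

/-- The curvature with a raised index is skew, `R^{dc}_{ab} = -R^{cd}_{ab}`: apply the commuting
derivations `∂_a`, `∂_b` to `g⁻¹` in both orders. -/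
lemma F_skew (a b : ι) : m.F a b * m.H = -(m.H * (m.F a b)ᵀ) := by
  have h := m.mD_comm a b m.H
  simp only [mD_H, mD_sub, mD_mul, mD_transpose, mD_neg] at h
  simp only [F, transpose_add, transpose_sub, transpose_mul]
  rw [← sub_eq_zero] at h ⊢
  rw [← neg_eq_zero, ← h]
  noncomm_ring

/-- The covariant derivative `∂_a T + [A_a, T]` of an endomorphism field. Further indices that `T`
may carry, such as the form indices of the curvature, are treated as mere labels. -/
def endD (a : ι) (T : Matrix ι ι R) : Matrix ι ι R := m.mD a T + (m.A a * T - T * m.A a)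

/-- The differential Bianchi identity; for label indices no torsion term appears. -/
lemma endD_cyclic (a b c : ι) :
    m.endD a (m.F b c) + m.endD b (m.F c a) + m.endD c (m.F a b) = 0 := by
  simp only [endD, F, mD_add, mD_sub, mD_mul, m.mD_comm b a, m.mD_comm c a, m.mD_comm c b]
  noncomm_ring

lemma endD_skew (a : ι) (T : Matrix ι ι R) (h : T * m.H = -(m.H * Tᵀ)) :
    m.endD a T * m.H = -(m.H * (m.endD a T)ᵀ) := by
  have h2 := congrArg (m.mD a) h
  rw [mD_neg, mD_mul, mD_mul, mD_H, mD_transpose] at h2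
  simp only [endD, transpose_add, transpose_sub, transpose_mul]
  rw [← sub_eq_zero] at h h2 ⊢
  have e : m.A a * (T * m.H - -(m.H * Tᵀ)) + (T * m.H - -(m.H * Tᵀ)) * (m.A a)ᵀ = 0 := by
    rw [h, mul_zero, zero_mul, add_zero]
  rw [← add_zero (0 : Matrix ι ι R)]
  nth_rewrite 1 [← h2]
  rw [← e]
  noncomm_ring

/-! ### Covariant derivatives, traces and divergences -/

/-- The covariant derivative of a one-form, `(cov1 θ) a b = ∇_a θ_b`. -/
def cov1 (θ : ι → R) : Matrix ι ι R := fun a b => m.D a (θ b) - ∑ c, m.A a c b * θ c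

/-- The covariant derivative of a covariant two-tensor, `(cov2 a T) b c = ∇_a T_{bc}`. -/
def cov2 (a : ι) (T : Matrix ι ι R) : Matrix ι ι R := m.mD a T - (m.A a)ᵀ * T - T * m.A a

lemma cov2_apply (a : ι) (T : Matrix ι ι R) (b c : ι) : m.cov2 a T b c =
    m.D a (T b c) - ∑ e, m.A a e b * T e c - ∑ e, T b e * m.A a e c := by
  simp [cov2, mD_apply, Matrix.mul_apply]

/-- The metric trace `g^{ab} T_{ab}`. -/
def tr (T : Matrix ι ι R) : R := ∑ a, ∑ b, m.H a b * T a b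

/-- The divergence `∇^a T_{ab}`. -/
def div2 (T : Matrix ι ι R) (b : ι) : R := ∑ a, ∑ c, m.H a c * m.cov2 a T c b

/-- The pairing of one-forms. -/
def pair (θ η : ι → R) : R := ∑ a, ∑ b, m.H a b * θ a * η b

/-- The vector `θ^a`. -/
def sharp (θ : ι → R) (a : ι) : R := ∑ b, m.H a b * θ b

lemma tr_eq_trace (T : Matrix ι ι R) : m.tr T = trace (m.H * T) := by
  rw [tr, trace, Finset.sum_comm]
  refine Finset.sum_congr rfl fun a _ => ?_
  rw [diag_apply, Matrix.mul_apply]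
  exact Finset.sum_congr rfl fun b _ => by rw [m.H_symm]

lemma D_tr (a : ι) (T : Matrix ι ι R) : m.D a (m.tr T) = m.tr (m.cov2 a T) := by
  have h : m.D a (trace (m.H * T)) = trace (m.mD a (m.H * T)) := by
    simp [trace, mD_apply]
  rw [tr_eq_trace, tr_eq_trace, h, mD_mul, mD_H, cov2, ← sub_eq_zero, ← trace_sub]
  have e : trace (m.H * (T * m.A a)) = trace (m.A a * (m.H * T)) := by
    rw [← mul_assoc, trace_mul_comm]
  simp only [sub_mul, mul_sub, neg_mul, trace_add, trace_sub, trace_neg, e, mul_assoc]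
  ring

/-! ### The Bianchi identities -/

/-- The full covariant derivative of the curvature: `(covF b a c) d e = ∇_b R^d_{eac}`. -/
def covF (b a c : ι) : Matrix ι ι R :=
  m.endD b (m.F a c) - ∑ f, m.A b f a • m.F f c - ∑ f, m.A b f c • m.F a f

lemma covF_cyclic (a b c : ι) : m.covF a b c + m.covF b c a + m.covF c a b = 0 := by
  have h := m.endD_cyclic a b c
  have e : ∀ x y z : ι, ∑ f, m.A x f y • m.F f z = - ∑ f, m.A y f x • m.F z f := by
    intro x y z
    rw [← Finset.sum_neg_distrib]
    exact Finset.sum_congr rfl fun f _ => by rw [m.A_symm x y, m.F_anti f z, smul_neg]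
  simp only [covF, e a b c, e b c a, e c a b]
  rw [← h]; abel

lemma endD_neg (a : ι) (T : Matrix ι ι R) : m.endD a (-T) = -m.endD a T := by
  simp only [endD, mD_neg]; noncomm_ring

lemma covF_anti (a b c : ι) : m.covF a b c = -m.covF a c b := by
  simp only [covF, m.F_anti b c, endD_neg, m.F_anti _ c, m.F_anti b _, smul_neg,
    Finset.sum_neg_distrib]
  abel

lemma covF_skew (a b c : ι) : m.covF a b c * m.H = -(m.H * (m.covF a b c)ᵀ) := by
  simp only [covF, transpose_sub, sub_mul, mul_sub, transpose_sum, Finset.sum_mul, Finset.mul_sum,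
    transpose_smul, smul_mul_assoc, mul_smul_comm, F_skew, m.endD_skew a _ (m.F_skew b c),
    smul_neg, Finset.sum_neg_distrib]
  abel

lemma cov2_Ric (b e c : ι) : m.cov2 b m.Ric e c = ∑ a, m.covF b a c a e := by
  have h : ∑ a, ∑ f, m.A b a f * m.F a c f e = ∑ a, ∑ f, m.A b f a * m.F f c a e :=
    Finset.sum_comm
  have h2 : ∑ f, m.A b f e * ∑ a, m.F a c a f = ∑ a, ∑ f, m.F a c a f * m.A b f e := by
    simp only [Finset.mul_sum]
    rw [Finset.sum_comm]
    simp only [mul_comm]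
  have h3 : ∑ f, (∑ a, m.F a f a e) * m.A b f c = ∑ a, ∑ f, m.A b f c * m.F a f a e := by
    simp only [Finset.sum_mul]
    rw [Finset.sum_comm]
    simp only [mul_comm]
  rw [cov2_apply]
  simp only [Ric, h2, h3, map_sum, covF, endD, Matrix.sub_apply, Matrix.add_apply,
    Matrix.sum_apply, Matrix.smul_apply, smul_eq_mul, Matrix.mul_apply, mD_apply,
    Finset.sum_sub_distrib, Finset.sum_add_distrib]
  linear_combination -h

/-- The contracted Bianchi identity `2 ∇^a R_{ab} = ∇_b R`. -/
lemma two_mul_div2_Ric (b : ι) : 2 * m.div2 m.Ric b = m.D b (m.tr m.Ric) := by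
  -- Contracting the first index of `∇_a R^a_{ecb} + ∇_c R^a_{eba} + ∇_b R^a_{eac} = 0`.
  have h1 (e c : ι) : ∑ a, m.covF a c b a e = m.cov2 c m.Ric e b - m.cov2 b m.Ric e c := by
    simp only [cov2_Ric, ← Finset.sum_sub_distrib]
    refine Finset.sum_congr rfl fun a _ => ?_
    have := congrFun (congrFun (m.covF_cyclic b a c) a) e
    rw [m.covF_anti c b a] at this
    simp only [Matrix.add_apply, Matrix.neg_apply, Matrix.zero_apply] at this
    linear_combination this
  have h2 (a c : ι) : ∑ e, m.covF a c b a e * m.H e c = -∑ e, m.H a e * m.covF a c b c e := by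
    have := congrFun (congrFun (m.covF_skew a c b) a) c
    simpa [Matrix.mul_apply] using this
  have h3 : ∑ e, ∑ c, m.H e c * ∑ a, m.covF a c b a e = - m.div2 m.Ric b := by
    calc ∑ e, ∑ c, m.H e c * ∑ a, m.covF a c b a e
        = ∑ a, ∑ c, ∑ e, m.covF a c b a e * m.H e c := by
          simp only [Finset.mul_sum]
          rw [Finset.sum_comm]
          simp only [mul_comm]
          exact (Finset.sum_congr rfl fun c _ => Finset.sum_comm).trans Finset.sum_comm
      _ = -∑ a, ∑ e, m.H a e * ∑ c, m.covF a c b c e := by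
          simp only [h2, Finset.sum_neg_distrib, Finset.mul_sum]
          congr 1
          exact Finset.sum_congr rfl fun a _ => Finset.sum_comm
      _ = _ := by simp only [div2, cov2_Ric]
  simp only [h1, mul_sub, Finset.sum_sub_distrib] at h3
  rw [D_tr]
  have h4 : ∑ e, ∑ c, m.H e c * m.cov2 c m.Ric e b = m.div2 m.Ric b := by
    rw [Finset.sum_comm]
    simp only [div2, m.H_symm]
  rw [h4] at h3
  rw [tr]
  linear_combination h3

/-! ### Product rules -/

lemma cov2_add (a : ι) (S T : Matrix ι ι R) : m.cov2 a (S + T) = m.cov2 a S + m.cov2 a T := by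
  simp only [cov2, mD_add]; noncomm_ring

lemma cov2_sub (a : ι) (S T : Matrix ι ι R) : m.cov2 a (S - T) = m.cov2 a S - m.cov2 a T := by
  simp only [cov2, mD_sub]; noncomm_ring

lemma cov2_smul (a : ι) (f : R) (T : Matrix ι ι R) :
    m.cov2 a (f • T) = f • m.cov2 a T + m.D a f • T := by
  have h : m.mD a (f • T) = f • m.mD a T + m.D a f • T := by
    ext; simp only [mD_apply, Matrix.add_apply, Matrix.smul_apply, smul_eq_mul, D_mul]; ring
  simp only [cov2, h, mul_smul_comm, smul_mul_assoc, smul_sub]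
  abel

lemma cov2_vecMulVec (a : ι) (θ η : ι → R) : m.cov2 a (vecMulVec θ η) =
    vecMulVec (m.cov1 θ a) η + vecMulVec θ (m.cov1 η a) := by
  ext b c
  simp only [cov2_apply, vecMulVec_apply, D_mul, cov1, Matrix.add_apply, sub_mul, mul_sub,
    Finset.sum_mul, Finset.mul_sum]
  have h1 : ∑ e, θ b * η e * m.A a e c = ∑ e, θ b * (m.A a e c * η e) :=
    Finset.sum_congr rfl fun e _ => by ring
  have h2 : ∑ e, m.A a e b * (θ e * η c) = ∑ e, m.A a e b * θ e * η c :=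
    Finset.sum_congr rfl fun e _ => by ring
  rw [h1, h2]; ring

lemma cov2_G (a : ι) : m.cov2 a m.G = 0 := by
  rw [cov2, mD_G]; abel

lemma div2_add (S T : Matrix ι ι R) (b : ι) : m.div2 (S + T) b = m.div2 S b + m.div2 T b := by
  simp [div2, cov2_add, mul_add, Finset.sum_add_distrib]

lemma div2_sub (S T : Matrix ι ι R) (b : ι) : m.div2 (S - T) b = m.div2 S b - m.div2 T b := by
  simp [div2, cov2_sub, mul_sub, Finset.sum_sub_distrib]

lemma div2_smul (f : R) (T : Matrix ι ι R) (b : ι) :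
    m.div2 (f • T) b = f * m.div2 T b + ∑ c, m.sharp (m.D · f) c * T c b := by
  simp only [div2, cov2_smul, Matrix.add_apply, Matrix.smul_apply, smul_eq_mul, mul_add,
    Finset.sum_add_distrib, sharp, Finset.mul_sum, Finset.sum_mul]
  rw [Finset.sum_comm (f := fun a c => m.H a c * (m.D a f * T c b))]
  congr 1
  · exact Finset.sum_congr rfl fun a _ => Finset.sum_congr rfl fun c _ => by ring
  · refine Finset.sum_congr rfl fun a _ => Finset.sum_congr rfl fun c _ => ?_
    rw [m.H_symm]; ring

lemma div2_G (b : ι) : m.div2 m.G b = 0 := by simp [div2, cov2_G]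

lemma div2_vecMulVec (θ η : ι → R) (b : ι) : m.div2 (vecMulVec θ η) b =
    m.tr (m.cov1 θ) * η b + ∑ a, m.sharp θ a * m.cov1 η a b := by
  simp only [div2, cov2_vecMulVec, Matrix.add_apply, vecMulVec_apply, mul_add,
    Finset.sum_add_distrib, tr, sharp, Finset.sum_mul, mul_assoc]

lemma tr_add (S T : Matrix ι ι R) : m.tr (S + T) = m.tr S + m.tr T := by
  simp [tr, mul_add, Finset.sum_add_distrib]

lemma tr_sub (S T : Matrix ι ι R) : m.tr (S - T) = m.tr S - m.tr T := by
  simp [tr, mul_sub, Finset.sum_sub_distrib]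

lemma tr_smul (f : R) (T : Matrix ι ι R) : m.tr (f • T) = f * m.tr T := by
  simp only [tr, Matrix.smul_apply, smul_eq_mul, Finset.mul_sum]
  exact Finset.sum_congr rfl fun a _ => Finset.sum_congr rfl fun c _ => by ring

lemma tr_G : m.tr m.G = (Fintype.card ι : R) := by
  rw [tr_eq_trace, m.mul_eq_one, trace_one]

lemma tr_vecMulVec (θ η : ι → R) : m.tr (vecMulVec θ η) = m.pair θ η := by
  simp only [tr, vecMulVec_apply, pair, mul_assoc]

lemma tr_transpose (T : Matrix ι ι R) : m.tr Tᵀ = m.tr T := by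
  rw [tr, Finset.sum_comm, tr]
  simp only [transpose_apply, m.H_symm]

lemma pair_eq_sum_sharp (θ η : ι → R) : m.pair θ η = ∑ a, m.sharp θ a * η a := by
  rw [pair, Finset.sum_comm]
  simp only [sharp, Finset.sum_mul, m.H_symm]

lemma pair_comm (θ η : ι → R) : m.pair θ η = m.pair η θ := by
  rw [pair, Finset.sum_comm, pair]
  exact Finset.sum_congr rfl fun a _ => Finset.sum_congr rfl fun c _ => by rw [m.H_symm]; ring

lemma D_pair (b : ι) (θ η : ι → R) :
    m.D b (m.pair θ η) = m.pair (m.cov1 θ b) η + m.pair θ (m.cov1 η b) := by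
  rw [← tr_vecMulVec, D_tr, cov2_vecMulVec, tr_add, tr_vecMulVec, tr_vecMulVec]

/-! ### Symmetrized derivatives and Hessians -/

/-- The symmetrized covariant derivative `∇_{(a} θ_{b)}`. -/
def sym1 (θ : ι → R) : Matrix ι ι R := fun a b => half R * (m.cov1 θ a b + m.cov1 θ b a)

lemma tr_sym1 (θ : ι → R) : m.tr (m.sym1 θ) = m.tr (m.cov1 θ) := by
  have h : m.sym1 θ = half R • (m.cov1 θ + (m.cov1 θ)ᵀ) := rfl
  rw [h, tr_smul, tr_add, tr_transpose]
  linear_combination m.tr (m.cov1 θ) * two_mul_half (R := R)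

/-- The Hessian `∇_a ∇_b f`. -/
def hess (f : R) : Matrix ι ι R := m.cov1 (m.D · f)

lemma hess_symm (f : R) : (m.hess f)ᵀ = m.hess f := by
  ext a b
  simp only [transpose_apply, hess, cov1, m.comm a b, m.A_symm a b]

lemma cov2_symm (a : ι) (T : Matrix ι ι R) (h : Tᵀ = T) : (m.cov2 a T)ᵀ = m.cov2 a T := by
  simp only [cov2, transpose_sub, transpose_mul, ← mD_transpose, h, transpose_transpose]
  abel

/-- The Ricci identity `[∇_a, ∇_b] θ_c = -R^e_{cab} θ_e` for a one-form. -/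
lemma cov2_cov1_comm (θ : ι → R) (a b c : ι) :
    m.cov2 a (m.cov1 θ) b c - m.cov2 b (m.cov1 θ) a c = -∑ e, m.F a b e c * θ e := by
  have h1 : ∑ e, m.A a e b * m.cov1 θ e c = ∑ e, m.A b e a * m.cov1 θ e c :=
    Finset.sum_congr rfl fun e _ => by rw [m.A_symm]
  have h2 (x y : ι) : ∑ e, ∑ d, m.A x e d * m.A y d c * θ e =
      ∑ e, ∑ d, m.A x d e * θ d * m.A y e c := by
    rw [Finset.sum_comm]
    exact Finset.sum_congr rfl fun _ _ => Finset.sum_congr rfl fun _ _ => by ring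
  rw [cov2_apply, cov2_apply, h1]
  simp only [cov1, map_sub, map_sum, D_mul, F, Matrix.add_apply, Matrix.sub_apply, mD_apply,
    Matrix.mul_apply, sub_mul, add_mul, Finset.sum_sub_distrib, Finset.sum_add_distrib,
    Finset.sum_mul, h2, m.comm a b]
  have h3 (x y : ι) : ∑ e, m.A x e c * m.D y (θ e) = ∑ e, m.D y (θ e) * m.A x e c :=
    Finset.sum_congr rfl fun _ _ => mul_comm _ _
  rw [h3, h3]
  ring

/-- The commutation formula `∇^a ∇_a ∇_b f = ∇_b Δf + R_{ab} ∇^a f`. -/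
lemma div2_hess (f : R) (b : ι) : m.div2 (m.hess f) b =
    m.D b (m.tr (m.hess f)) + ∑ c, m.sharp (m.D · f) c * m.Ric c b := by
  have h1 (a c : ι) : m.cov2 a (m.hess f) c b =
      m.cov2 b (m.hess f) a c - ∑ e, m.F a b e c * m.D e f := by
    have := m.cov2_cov1_comm (m.D · f) a b c
    rw [← transpose_apply (m.cov2 a (m.hess f)), m.cov2_symm a _ (m.hess_symm f)]
    change m.cov2 a (m.hess f) b c - m.cov2 b (m.hess f) a c = _ at this
    linear_combination this
  have h2 (a e : ι) : ∑ c, m.F a b e c * m.H c a = -∑ c, m.H e c * m.F a b a c := by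
    have := congrFun (congrFun (m.F_skew a b) e) a
    simpa [Matrix.mul_apply] using this
  have h3 : ∑ a, ∑ c, m.H a c * ∑ e, m.F a b e c * m.D e f =
      -∑ c, m.sharp (m.D · f) c * m.Ric c b := by
    calc ∑ a, ∑ c, m.H a c * ∑ e, m.F a b e c * m.D e f
        = ∑ a, ∑ e, (∑ c, m.F a b e c * m.H c a) * m.D e f := by
          refine Finset.sum_congr rfl fun a _ => ?_
          simp only [Finset.mul_sum, Finset.sum_mul]
          rw [Finset.sum_comm]
          exact Finset.sum_congr rfl fun _ _ => Finset.sum_congr rfl fun c _ => by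
            rw [m.H_symm a c]; ring
      _ = -∑ c, m.sharp (m.D · f) c * m.Ric c b := by
          simp only [h2, neg_mul, Finset.sum_neg_distrib, sharp, Ric, Finset.sum_mul,
            Finset.mul_sum]
          congr 1
          rw [Finset.sum_congr rfl fun a _ => Finset.sum_comm, Finset.sum_comm]
          refine Finset.sum_congr rfl fun c _ => ?_
          exact Finset.sum_congr rfl fun e _ => Finset.sum_congr rfl fun a _ => by
            rw [m.H_symm]; ring
  rw [D_tr]
  simp only [div2, h1, mul_sub, Finset.sum_sub_distrib, h3, tr]
  ring

lemma cov1_eq (θ : ι → R) (a : ι) : m.cov1 θ a = (fun b => m.D a (θ b)) - (m.A a)ᵀ *ᵥ θ := by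
  ext b; simp [cov1, mulVec, dotProduct]

lemma D_mulVec (a : ι) (T : Matrix ι ι R) (v : ι → R) :
    (fun b => m.D a ((T *ᵥ v) b)) = m.mD a T *ᵥ v + T *ᵥ fun b => m.D a (v b) := by
  ext b
  simp only [mulVec, dotProduct, map_sum, D_mul, Finset.sum_add_distrib, Pi.add_apply, mD_apply]

lemma sharp_eq (θ : ι → R) : m.sharp θ = m.H *ᵥ θ := rfl

lemma cov1_mulVec_sharp (T : Matrix ι ι R) (θ : ι → R) (a : ι) :
    m.cov1 (T *ᵥ m.sharp θ) a = m.cov2 a T *ᵥ m.sharp θ + T *ᵥ m.sharp (m.cov1 θ a) := by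
  simp only [cov1_eq, sharp_eq]
  rw [D_mulVec, D_mulVec, mD_H, cov2]
  simp only [mulVec_sub, mulVec_add, mulVec_neg, mulVec_mulVec, mul_assoc, sub_mul, sub_mulVec,
    neg_mulVec]
  abel

/-- The product rule `∇^a (T_{ab} θ^b) = θ^b ∇^a T_{ab} + T_{ab} ∇^a θ^b`. -/
lemma tr_cov1_mulVec_sharp (T : Matrix ι ι R) (θ : ι → R) :
    m.tr (m.cov1 (T *ᵥ m.sharp θ)) = ∑ b, m.sharp θ b * m.div2 T b +
      ∑ a, ∑ b, m.H a b * (T *ᵥ m.sharp (m.cov1 θ a)) b := by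
  have h : ∑ b, m.sharp θ b * m.div2 T b =
      ∑ a, ∑ b, m.H a b * (m.cov2 a T *ᵥ m.sharp θ) b := by
    simp only [div2, mulVec, dotProduct, Finset.mul_sum]
    rw [Finset.sum_comm]
    refine Finset.sum_congr rfl fun a _ => ?_
    rw [Finset.sum_comm]
    exact Finset.sum_congr rfl fun _ _ => Finset.sum_congr rfl fun _ _ => by ring
  rw [h]
  simp only [tr, cov1_mulVec_sharp, Pi.add_apply, mul_add, Finset.sum_add_distrib]

lemma cov1_sub (θ η : ι → R) : m.cov1 (fun a => θ a - η a) = m.cov1 θ - m.cov1 η := by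
  ext a b
  simp only [cov1, map_sub, Matrix.sub_apply, mul_sub, Finset.sum_sub_distrib]; ring

lemma tr_cov1_mul (f : R) (θ : ι → R) : m.tr (m.cov1 (fun a => f * θ a)) =
    f * m.tr (m.cov1 θ) + ∑ b, m.sharp θ b * m.D b f := by
  have h : m.cov1 (fun a => f * θ a) = f • m.cov1 θ + vecMulVec (m.D · f) θ := by
    ext a b
    simp only [cov1, D_mul, Matrix.add_apply, Matrix.smul_apply, smul_eq_mul, vecMulVec_apply,
      mul_sub, Finset.mul_sum]
    rw [Finset.sum_congr rfl fun c _ => (mul_left_comm (m.A a c b) f (θ c))]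
    ring
  rw [h, tr_add, tr_smul, tr_vecMulVec, pair_comm, pair_eq_sum_sharp]

lemma sum_sharp_mul_G (θ : ι → R) (b : ι) : ∑ c, m.sharp θ c * m.G c b = θ b := by
  have h : m.G *ᵥ m.sharp θ = θ := by rw [sharp_eq, mulVec_mulVec, G_mul_H, one_mulVec]
  conv_rhs => rw [← h]
  simp only [mulVec, dotProduct]
  exact Finset.sum_congr rfl fun c _ => by rw [m.symm, mul_comm]

lemma sharp_mul (x : R) (θ : ι → R) (c : ι) : m.sharp (fun a => x * θ a) c = x * m.sharp θ c := by
  simp only [sharp, Finset.mul_sum]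
  exact Finset.sum_congr rfl fun _ _ => by ring

/-! ### The horizon equation -/

section Horizon

variable {f p lam : R} {K : ι → R}

/-- The formula for `∇^a ∇_{(a} K_{b)}` obtained from the divergence of the horizon equation, with
the curvature eliminated through the contracted Bianchi identity. Here `p = 1 / f`. -/
lemma div2_sym1_of_horizon (hfp : f * p = 1) (hlam : ∀ a, m.D a lam = 0)
    (hE : m.Ric = (half R * p ^ 2) • vecMulVec K K - (half R * p ^ 2) •
      vecMulVec (m.D · f) (m.D · f) - p • m.sym1 K + p • m.hess f + lam • m.G) (b : ι) :
    m.div2 (m.sym1 K) b =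
      half R * p * (m.tr (m.cov1 K) * K b + ∑ a, m.sharp K a * m.cov1 K a b)
      - half R * p ^ 2 * m.pair K (m.D · f) * K b + half R * m.D b (m.tr (m.hess f))
      + lam * m.D b f - half R * p * ∑ a, m.sharp K a * m.cov1 K b a
      + half R * p ^ 2 * m.pair K K * m.D b f + half R * m.D b (m.tr (m.cov1 K))
      - half R * p * m.tr (m.cov1 K) * m.D b f := by
  have hh := two_mul_half (R := R)
  have hDp (a : ι) : m.D a p = - p ^ 2 * m.D a f := by
    have := congrArg (m.D a) hfp
    rw [D_mul, Derivation.map_one_eq_zero] at this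
    linear_combination p * this - m.D a p * hfp
  have hDhp (a : ι) : m.D a (half R * p) = - (half R * p ^ 2) * m.D a f := by
    rw [D_mul, D_half, hDp]; ring
  have hDlf (a : ι) : m.D a (lam * f) = lam * m.D a f := by
    rw [D_mul, hlam]; ring
  have hE2 : f • m.Ric = (half R * p) • vecMulVec K K - (half R * p) •
      vecMulVec (m.D · f) (m.D · f) - m.sym1 K + m.hess f + (lam * f) • m.G := by
    rw [hE]
    ext i j
    simp only [Matrix.smul_apply, Matrix.add_apply, Matrix.sub_apply, smul_eq_mul]
    linear_combination (half R * p * (vecMulVec K K i j - vecMulVec (m.D · f) (m.D · f) i j)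
      - m.sym1 K i j + m.hess f i j) * hfp
  -- The divergence of the equation for `f R_{ab}`.
  have hdiv := congrArg (m.div2 · b) hE2
  simp only [div2_add, div2_sub, div2_smul, div2_G, div2_vecMulVec, vecMulVec_apply, hDhp, hDlf,
    sharp_mul, div2_hess, mul_assoc, ← Finset.mul_sum, sum_sharp_mul_G] at hdiv
  simp only [← mul_assoc, ← Finset.sum_mul, ← pair_eq_sum_sharp] at hdiv
  -- Its trace, and the gradient of that trace.
  have htr := congrArg m.tr hE2
  simp only [tr_add, tr_sub, tr_smul, tr_vecMulVec, tr_sym1, tr_G] at htr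
  have hDtr := congrArg (m.D b) htr
  simp only [map_add, map_sub, D_mul, hDhp, hlam, D_pair,
    Derivation.map_natCast] at hDtr
  have hB := m.two_mul_div2_Ric b
  have e1 (θ : ι → R) : m.pair (m.cov1 θ b) θ + m.pair θ (m.cov1 θ b) =
      2 * ∑ a, m.sharp θ a * m.cov1 θ b a := by
    rw [pair_comm, pair_eq_sum_sharp]; ring
  rw [e1, e1] at hDtr
  have e2 : m.cov1 (m.D · f) = m.hess f := rfl
  have e3 : ∑ a, m.sharp (m.D · f) a * m.hess f b a =
     ∑ a, m.sharp (m.D · f) a * m.hess f a b := by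
    refine Finset.sum_congr rfl fun a _ => ?_
    rw [← m.hess_symm, transpose_apply, m.hess_symm]
  rw [e2, e3] at hDtr
  rw [e2] at hdiv
  rw [m.pair_comm (m.D · f) K] at hdiv
  simp only [pair_eq_sum_sharp] at hdiv htr hDtr ⊢
  linear_combination hdiv - half R * f * hB - half R * hDtr + half R * p * m.D b f * htr
    + (half R * m.D b f * lam * Fintype.card ι - half R * m.D b f * m.tr m.Ric) * hfp
    + (f * m.div2 m.Ric b - m.D b (m.tr (m.hess f))
      - half R * p * ∑ a, m.sharp K a * m.cov1 K b a
      + half R * p * ∑ a, m.sharp (m.D · f) a * m.hess f a b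
      - half R * p ^ 2 * m.D b f * ∑ a, m.sharp (m.D · f) a * m.D a f
      + half R * p ^ 2 * m.D b f * ∑ a, m.sharp K a * K a) * hh

/-- The algebraic form of the identity, with `p = 1 / f`. -/
theorem horizon_identity (hfp : f * p = 1) (hlam : ∀ a, m.D a lam = 0)
    (hE : m.Ric = (half R * p ^ 2) • vecMulVec K K - (half R * p ^ 2) •
      vecMulVec (m.D · f) (m.D · f) - p • m.sym1 K + p • m.hess f + lam • m.G) :
    ∑ a, ∑ b, ∑ c, ∑ d, m.H a c * m.H b d * m.sym1 K a b * m.cov1 K c d =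
      m.tr (m.cov1 fun a => ∑ b, ∑ c, m.H b c * K c * m.sym1 K a b
        - half R * K a * m.tr (m.hess f) - half R * K a * m.tr (m.cov1 K) - lam * f * K a)
      + m.tr (m.cov1 K) * (-(half R * p) * m.pair K K + half R * m.tr (m.hess f)
        + half R * m.tr (m.cov1 K) + half R * p * m.pair K (m.D · f) + lam * f) := by
  have hω : (fun a => ∑ b, ∑ c, m.H b c * K c * m.sym1 K a b
        - half R * K a * m.tr (m.hess f) - half R * K a * m.tr (m.cov1 K) - lam * f * K a) =
      fun a => (m.sym1 K *ᵥ m.sharp K) a - (half R * m.tr (m.hess f)) * K a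
        - (half R * m.tr (m.cov1 K)) * K a - (lam * f) * K a := by
    ext a
    have : ∑ b, ∑ c, m.H b c * K c * m.sym1 K a b = (m.sym1 K *ᵥ m.sharp K) a := by
      simp only [mulVec, dotProduct, sharp, Finset.mul_sum]
      exact Finset.sum_congr rfl fun _ _ => Finset.sum_congr rfl fun _ _ => by ring
    rw [this]; ring
  have hsq : ∑ a, ∑ b, m.H a b * (m.sym1 K *ᵥ m.sharp (m.cov1 K a)) b =
      ∑ a, ∑ b, ∑ c, ∑ d, m.H a c * m.H b d * m.sym1 K a b * m.cov1 K c d := by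
    rw [Finset.sum_comm]
    refine Finset.sum_congr rfl fun a _ => ?_
    simp only [mulVec, dotProduct, sharp, Finset.mul_sum]
    rw [Finset.sum_comm]
    exact Finset.sum_congr rfl fun b _ => Finset.sum_congr rfl fun c _ =>
      Finset.sum_congr rfl fun d _ => by rw [m.H_symm a c]; ring
  have hV : ∑ b, m.sharp K b * m.div2 (m.sym1 K) b =
      half R * p * m.tr (m.cov1 K) * m.pair K K
      + half R * ∑ b, m.sharp K b * m.D b (m.tr (m.hess f))
      + lam * m.pair K (m.D · f) + half R * ∑ b, m.sharp K b * m.D b (m.tr (m.cov1 K))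
      - half R * p * m.tr (m.cov1 K) * m.pair K (m.D · f) := by
    -- `K^a K^b ∇_a K_b` is symmetric in the two contractions, so its two occurrences cancel.
    have hswap : ∑ b, m.sharp K b * ∑ a, m.sharp K a * m.cov1 K a b =
        ∑ b, m.sharp K b * ∑ a, m.sharp K a * m.cov1 K b a := by
      simp only [Finset.mul_sum]
      rw [Finset.sum_comm]
      exact Finset.sum_congr rfl fun _ _ => Finset.sum_congr rfl fun _ _ => by ring
    have key : ∑ b, m.sharp K b * m.div2 (m.sym1 K) b =
        half R * p * m.tr (m.cov1 K) * ∑ b, m.sharp K b * K b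
        + half R * p * ∑ b, m.sharp K b * ∑ a, m.sharp K a * m.cov1 K a b
        - half R * p ^ 2 * m.pair K (m.D · f) * ∑ b, m.sharp K b * K b
        + half R * ∑ b, m.sharp K b * m.D b (m.tr (m.hess f))
        + lam * ∑ b, m.sharp K b * m.D b f
        - half R * p * ∑ b, m.sharp K b * ∑ a, m.sharp K a * m.cov1 K b a
        + half R * p ^ 2 * m.pair K K * ∑ b, m.sharp K b * m.D b f
        + half R * ∑ b, m.sharp K b * m.D b (m.tr (m.cov1 K))
        - half R * p * m.tr (m.cov1 K) * ∑ b, m.sharp K b * m.D b f := by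
      simp only [Finset.mul_sum (s := Finset.univ) (a := half R * p * m.tr (m.cov1 K)),
        Finset.mul_sum (s := Finset.univ) (a := half R * p),
        Finset.mul_sum (s := Finset.univ) (a := half R * p ^ 2 * m.pair K (m.D · f)),
        Finset.mul_sum (s := Finset.univ) (a := half R * p ^ 2 * m.pair K K),
        Finset.mul_sum (s := Finset.univ) (a := half R),
        Finset.mul_sum (s := Finset.univ) (a := lam),
        ← Finset.sum_add_distrib, ← Finset.sum_sub_distrib]
      refine Finset.sum_congr rfl fun b _ => ?_
      rw [m.div2_sym1_of_horizon hfp hlam hE]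
      ring
    rw [key, hswap]
    simp only [pair_eq_sum_sharp]
    ring
  have hD1 (x : R) (b : ι) : m.D b (half R * x) = half R * m.D b x := by
    rw [D_mul, D_half]; ring
  have hD2 (b : ι) : m.D b (lam * f) = lam * m.D b f := by
    rw [D_mul, hlam]; ring
  rw [hω, cov1_sub, cov1_sub, cov1_sub, tr_sub, tr_sub, tr_sub, tr_cov1_mul, tr_cov1_mul,
    tr_cov1_mul, tr_cov1_mulVec_sharp, hV, hsq]
  simp only [hD1, hD2, mul_left_comm _ (half R), mul_left_comm _ lam, ← Finset.mul_sum,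
    ← pair_eq_sum_sharp]
  ring

end Horizon

end MetricRing

/-! ### The ring of smooth functions on an open set -/

section SmoothRing

variable {n : ℕ} {U : Set (EuclideanSpace ℝ (Fin n))}

/-- The algebra of smooth functions on `U`. Its elements are functions on the subtype `U`, not on
the whole space, so that equality in the ring is equality on `U`. -/
def smoothRing (U : Set (EuclideanSpace ℝ (Fin n))) : Subalgebra ℝ (U → ℝ) where
  carrier := {h | ∃ F : EuclideanSpace ℝ (Fin n) → ℝ, ContDiffOn ℝ ∞ F U ∧ ∀ u : U, F u = h u}
  mul_mem' := by
    rintro _ _ ⟨F, hF, hF'⟩ ⟨F₂, hF₂, hF₂'⟩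
    exact ⟨F * F₂, hF.mul hF₂, fun u => by simp [hF', hF₂']⟩
  add_mem' := by
    rintro _ _ ⟨F, hF, hF'⟩ ⟨F₂, hF₂, hF₂'⟩
    exact ⟨F + F₂, hF.add hF₂, fun u => by simp [hF', hF₂']⟩
  algebraMap_mem' r := ⟨fun _ => r, contDiffOn_const, fun _ => rfl⟩

/-- Evaluation at a point of `U`. -/
def ev (u : U) : smoothRing U →ₐ[ℝ] ℝ :=
  (Pi.evalAlgHom ℝ (fun _ : U => ℝ) u).comp (smoothRing U).val

lemma smoothRing_ext {x y : smoothRing U} (h : ∀ u, ev u x = ev u y) : x = y :=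
  Subtype.ext (funext h)

/-- The function `F` on the whole space restricts to `h` on `U`; its values outside `U` are
arbitrary. -/
def Rep (F : EuclideanSpace ℝ (Fin n) → ℝ) (h : smoothRing U) : Prop := ∀ u : U, F u = ev u h

/-- The restriction to `U` of a function that is smooth on `U`. -/
def ofContDiffOn (F : EuclideanSpace ℝ (Fin n) → ℝ) (hF : ContDiffOn ℝ ∞ F U) : smoothRing U :=
  ⟨fun u => F u, F, hF, fun _ => rfl⟩

lemma rep_ofContDiffOn (F : EuclideanSpace ℝ (Fin n) → ℝ) (hF : ContDiffOn ℝ ∞ F U) :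
    Rep F (ofContDiffOn F hF) := fun _ => rfl

lemma exists_rep (h : smoothRing U) :
    ∃ F : EuclideanSpace ℝ (Fin n) → ℝ, ContDiffOn ℝ ∞ F U ∧ Rep F h := h.2

lemma contDiffOn_pd (hU : IsOpen U) (a : Fin n) {F : EuclideanSpace ℝ (Fin n) → ℝ}
    (hF : ContDiffOn ℝ ∞ F U) : ContDiffOn ℝ ∞ (pd a F) U :=
  (hF.fderiv_of_isOpen hU (by simp)).clm_apply contDiffOn_const

lemma pd_congr (hU : IsOpen U) (a : Fin n) {F F₂ : EuclideanSpace ℝ (Fin n) → ℝ}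
    (h : ∀ u : U, F u = F₂ u) (u : U) : pd a F u = pd a F₂ u := by
  have : F =ᶠ[nhds (u : EuclideanSpace ℝ (Fin n))] F₂ :=
    Filter.eventually_of_mem (hU.mem_nhds u.2) fun v hv => h ⟨v, hv⟩
  rw [pd, pd, this.fderiv_eq]

lemma differentiableAt_of_contDiffOn (hU : IsOpen U) {F : EuclideanSpace ℝ (Fin n) → ℝ}
    (hF : ContDiffOn ℝ ∞ F U) (u : U) : DifferentiableAt ℝ F u :=
  (hF.contDiffAt (hU.mem_nhds u.2)).differentiableAt (by simp)

/-- The partial derivative `∂_a h` on `U`. It is taken on a chosen extension of `h`; since `U` is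
open, the choice does not matter (`Rep.pdFun`). -/
def pdFun (hU : IsOpen U) (a : Fin n) (h : smoothRing U) : smoothRing U :=
  ofContDiffOn (pd a h.2.choose) (contDiffOn_pd hU a h.2.choose_spec.1)

lemma Rep.pdFun (hU : IsOpen U) (a : Fin n) {F : EuclideanSpace ℝ (Fin n) → ℝ} {h : smoothRing U}
    (hF : Rep F h) : Rep (pd a F) (pdFun hU a h) := fun u =>
  pd_congr hU a (fun v => (hF v).trans (h.2.choose_spec.2 v).symm) u

/-- The partial derivative `∂_a` as a derivation of the ring of smooth functions on `U`. -/
def pdDer (hU : IsOpen U) (a : Fin n) : Derivation ℝ (smoothRing U) (smoothRing U) :=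
  Derivation.mk'
    { toFun := pdFun hU a
      map_add' := fun x y => smoothRing_ext fun u => by
        obtain ⟨F, hF, hFx⟩ := exists_rep x
        obtain ⟨F₂, hF₂, hFy⟩ := exists_rep y
        have hs : Rep (F + F₂) (x + y) := fun v => by simp [hFx v, hFy v]
        rw [map_add, ← hFx.pdFun hU a u, ← hFy.pdFun hU a u, ← hs.pdFun hU a u, pd, pd, pd,
          fderiv_add (differentiableAt_of_contDiffOn hU hF u)
            (differentiableAt_of_contDiffOn hU hF₂ u)]
        rfl
      map_smul' := fun r x => smoothRing_ext fun u => by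
        obtain ⟨F, hF, hFx⟩ := exists_rep x
        have hs : Rep (r • F) (r • x) := fun v => by simp [hFx v]
        rw [RingHom.id_apply, map_smul, ← hFx.pdFun hU a u, ← hs.pdFun hU a u, pd, pd,
          fderiv_const_smul (differentiableAt_of_contDiffOn hU hF u)]
        rfl }
    fun x y => smoothRing_ext fun u => by
      obtain ⟨F, hF, hFx⟩ := exists_rep x
      obtain ⟨F₂, hF₂, hFy⟩ := exists_rep y
      have hs : Rep (F * F₂) (x * y) := fun v => by simp [hFx v, hFy v]
      simp only [LinearMap.coe_mk, AddHom.coe_mk, smul_eq_mul, map_add, map_mul]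
      rw [← hFx.pdFun hU a u, ← hFy.pdFun hU a u, ← hs.pdFun hU a u, pd, pd, pd,
        fderiv_mul (differentiableAt_of_contDiffOn hU hF u)
          (differentiableAt_of_contDiffOn hU hF₂ u), ← hFx u, ← hFy u]
      simp

lemma Rep.pd (hU : IsOpen U) (a : Fin n) {F : EuclideanSpace ℝ (Fin n) → ℝ} {h : smoothRing U}
    (hF : Rep F h) : Rep (pd a F) (pdDer hU a h) := hF.pdFun hU a

lemma pdDer_comm (hU : IsOpen U) (a b : Fin n) (x : smoothRing U) :
    pdDer hU a (pdDer hU b x) = pdDer hU b (pdDer hU a x) := by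
  refine smoothRing_ext fun u => ?_
  obtain ⟨F, hF, hFx⟩ := exists_rep x
  have h2 (c d : Fin n) : HorizonIdentity.pd c (HorizonIdentity.pd d F) u =
      fderiv ℝ (fderiv ℝ F) u (EuclideanSpace.single c 1) (EuclideanSpace.single d 1) := by
    have hd : DifferentiableAt ℝ (fderiv ℝ F) u :=
      ((hF.fderiv_of_isOpen hU (m := ∞) (by simp)).contDiffAt
        (hU.mem_nhds u.2)).differentiableAt (by simp)
    change fderiv ℝ (fun v => fderiv ℝ F v (EuclideanSpace.single d 1)) u _ = _
    rw [fderiv_clm_apply hd (by fun_prop)]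
    simp
  rw [← (hFx.pd hU b).pd hU a u, ← (hFx.pd hU a).pd hU b u, h2, h2]
  exact ((hF.contDiffAt (hU.mem_nhds u.2)).isSymmSndFDerivAt
    (by rw [minSmoothness_of_isRCLikeNormedField]; exact WithTop.coe_le_coe.2 le_top)).eq _ _

lemma isUnit_of_ne_zero {x : smoothRing U} (hx : ∀ u, ev u x ≠ 0) : IsUnit x := by
  obtain ⟨F, hF, hFx⟩ := exists_rep x
  have hi : ContDiffOn ℝ ∞ (fun v => (F v)⁻¹) U :=
    hF.inv fun v hv => by rw [hFx ⟨v, hv⟩]; exact hx _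
  refine IsUnit.of_mul_eq_one (ofContDiffOn _ hi) (smoothRing_ext fun u => ?_)
  rw [map_mul, map_one, ← rep_ofContDiffOn _ hi u, ← hFx u]
  exact mul_inv_cancel₀ (by rw [hFx u]; exact hx u)

end SmoothRing

/-! ### Tensor fields in coordinates -/

section Bridge

variable {n : ℕ} {U : Set (EuclideanSpace ℝ (Fin n))}
  {G : EuclideanSpace ℝ (Fin n) → Matrix (Fin n) (Fin n) ℝ}

/-- `G` is a smooth field of symmetric nondegenerate matrices on the open set `U`; definiteness
plays no role in the local computation. -/
structure IsMetricOn (G : EuclideanSpace ℝ (Fin n) → Matrix (Fin n) (Fin n) ℝ)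
    (U : Set (EuclideanSpace ℝ (Fin n))) : Prop where
  isOpen : IsOpen U
  contDiffOn : ∀ a b, ContDiffOn ℝ ∞ (fun u => G u a b) U
  symm : ∀ u ∈ U, ∀ a b, G u a b = G u b a
  det_ne_zero : ∀ u ∈ U, (G u).det ≠ 0

namespace IsMetricOn

/-- The components of the metric, as a matrix over the ring of smooth functions on `U`. -/
def matrix (hm : IsMetricOn G U) : Matrix (Fin n) (Fin n) (smoothRing U) :=
  fun a b => ofContDiffOn _ (hm.contDiffOn a b)

variable (hm : IsMetricOn G U)

lemma map_ev_matrix (u : U) : hm.matrix.map (ev u) = G u := by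
  ext a b; exact (rep_ofContDiffOn _ (hm.contDiffOn a b) u).symm

lemma isUnit_det_matrix : IsUnit hm.matrix.det :=
  isUnit_of_ne_zero fun u => by
    have : ev u hm.matrix.det = (G u).det := by
      rw [← hm.map_ev_matrix u]
      exact (ev u).toRingHom.map_det _
    rw [this]; exact hm.det_ne_zero u u.2

lemma map_ev_inv_matrix (u : U) : (hm.matrix⁻¹).map (ev u) = (G u)⁻¹ := by
  refine (Matrix.inv_eq_left_inv ?_).symm
  rw [← hm.map_ev_matrix u]
  have := congrArg (fun T => T.map (ev u))
    (Matrix.nonsing_inv_mul _ hm.isUnit_det_matrix)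
  simpa [Matrix.map_mul] using this

/-- The smooth functions on `U` with their partial derivatives and the metric `G`. -/
def metricRing : MetricRing (smoothRing U) (Fin n) where
  D := pdDer hm.isOpen
  comm := pdDer_comm hm.isOpen
  G := hm.matrix
  H := hm.matrix⁻¹
  symm a b := smoothRing_ext fun u => hm.symm u u.2 a b
  mul_eq_one := Matrix.nonsing_inv_mul _ hm.isUnit_det_matrix

lemma inv_apply_eq_ev (a b : Fin n) (u : U) : (G u)⁻¹ a b = ev u (hm.metricRing.H a b) :=
  (congrFun (congrFun (hm.map_ev_inv_matrix u) a) b).symm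

lemma ev_half (u : U) : ev u (MetricRing.half (smoothRing U)) = 1 / 2 := (ev u).commutes _

lemma rep_G (a b : Fin n) : Rep (fun v => G v a b) (hm.metricRing.G a b) :=
  rep_ofContDiffOn _ (hm.contDiffOn a b)

variable {F : EuclideanSpace ℝ (Fin n) → ℝ} {h : smoothRing U}
  {θ η : Fin n → EuclideanSpace ℝ (Fin n) → ℝ} {x y : Fin n → smoothRing U}

lemma rep_pd (hF : Rep F h) (a : Fin n) : Rep (pd a F) (hm.metricRing.D a h) := hF.pd hm.isOpen a

lemma rep_christoffel (c a b : Fin n) : Rep (christoffel G c a b) (hm.metricRing.A a c b) :=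
    fun u => by
  simp only [christoffel, MetricRing.A, map_mul, map_sum, map_sub, map_add, ev_half,
    hm.inv_apply_eq_ev,
    fun a b c => hm.rep_pd (hm.rep_G a b) c u]

lemma rep_riemann (d c a b : Fin n) : Rep (riemann G d c a b) (hm.metricRing.F a b d c) :=
    fun u => by
  simp only [riemann, MetricRing.F, Matrix.add_apply, Matrix.sub_apply, Matrix.mul_apply, map_mul,
    map_sum, map_sub, map_add, MetricRing.mD_apply, Finset.sum_sub_distrib,
    fun a b c => hm.rep_christoffel a b c u,
    fun a b c d => hm.rep_pd (hm.rep_christoffel a b c) d u]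

lemma rep_ricci (a b : Fin n) : Rep (ricci G a b) (hm.metricRing.Ric a b) := fun u => by
  simp only [ricci, MetricRing.Ric, map_sum, fun a b c d => hm.rep_riemann a b c d u]

lemma rep_covDeriv (hθ : ∀ a, Rep (θ a) (x a)) (a b : Fin n) :
    Rep (covDeriv G θ a b) (hm.metricRing.cov1 x a b) := fun u => by
  simp only [covDeriv, MetricRing.cov1, map_sum, map_sub, map_mul,
    fun a b c => hm.rep_christoffel a b c u, fun a => hθ a u,
    fun b a => hm.rep_pd (hθ b) a u]

lemma rep_symCovDeriv (hθ : ∀ a, Rep (θ a) (x a)) (a b : Fin n) :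
    Rep (symCovDeriv G θ a b) (hm.metricRing.sym1 x a b) := fun u => by
  simp only [symCovDeriv, MetricRing.sym1, map_add, map_mul, ev_half,
    fun a b => hm.rep_covDeriv hθ a b u]

lemma rep_divergence (hθ : ∀ a, Rep (θ a) (x a)) :
    Rep (divergence G θ) (hm.metricRing.tr (hm.metricRing.cov1 x)) := fun u => by
  simp only [divergence, MetricRing.tr, map_sum, map_mul, hm.inv_apply_eq_ev,
    fun a b => hm.rep_covDeriv hθ a b u]

lemma rep_grad (hF : Rep F h) (a : Fin n) : Rep (grad F a) (hm.metricRing.D a h) :=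
  hF.pd hm.isOpen a

lemma rep_pairing (hθ : ∀ a, Rep (θ a) (x a)) (hη : ∀ a, Rep (η a) (y a)) :
    Rep (pairing G θ η) (hm.metricRing.pair x y) := fun u => by
  simp only [pairing, MetricRing.pair, map_sum, map_mul, hm.inv_apply_eq_ev,
    fun a => hθ a u, fun a => hη a u]

/-- The identity for a solution of the horizon equation on an open subset of `ℝⁿ`. -/
theorem coordinate_identity (hm : IsMetricOn G U)
    {K : Fin n → EuclideanSpace ℝ (Fin n) → ℝ}
    (hK : ∀ a, ContDiffOn ℝ ∞ (K a) U) {f : EuclideanSpace ℝ (Fin n) → ℝ}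
    (hf : ContDiffOn ℝ ∞ f U) (hf0 : ∀ u ∈ U, f u ≠ 0) {lam : ℝ}
    (hsol : ∀ u ∈ U, HorizonEquationAt G K f lam u) {u : EuclideanSpace ℝ (Fin n)} (hu : u ∈ U) :
    symCovDerivSq G K u = divergence G (fun a v => symCovDerivContract G K a v
          - 1 / 2 * K a v * laplacian G f v - 1 / 2 * K a v * divergence G K v
          - lam * f v * K a v) u
        + divergence G K u * (-(1 / (2 * f u)) * pairing G K K u + 1 / 2 * laplacian G f u
          + 1 / 2 * divergence G K u + 1 / (2 * f u) * pairing G K (grad f) u + lam * f u) := by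
  lift u to U using hu
  set x : Fin n → smoothRing U := fun a => ofContDiffOn _ (hK a)
  have hx : ∀ a, Rep (K a) (x a) := fun a => rep_ofContDiffOn _ (hK a)
  set F : smoothRing U := ofContDiffOn _ hf
  have hF : Rep f F := rep_ofContDiffOn _ hf
  have hp : ContDiffOn ℝ ∞ (fun v => (f v)⁻¹) U := hf.inv hf0
  set p : smoothRing U := ofContDiffOn _ hp
  have hpF : Rep (fun v => (f v)⁻¹) p := rep_ofContDiffOn _ hp
  set L : smoothRing U := algebraMap ℝ _ lam
  have hL (v : U) : ev v L = lam := (ev v).commutes _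
  have hfp : F * p = 1 := smoothRing_ext fun v => by
    rw [map_mul, map_one, ← hF v, ← hpF v, mul_inv_cancel₀ (hf0 v v.2)]
  have hg := hm.rep_grad hF
  have hdiv := hm.rep_divergence hx
  have hlap : Rep (laplacian G f) (hm.metricRing.tr (hm.metricRing.hess F)) := hm.rep_divergence hg
  have hE : hm.metricRing.Ric = (MetricRing.half _ * p ^ 2) • Matrix.vecMulVec x x
      - (MetricRing.half _ * p ^ 2) • Matrix.vecMulVec (hm.metricRing.D · F) (hm.metricRing.D · F)
      - p • hm.metricRing.sym1 x + p • hm.metricRing.hess F + L • hm.metricRing.G := by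
    refine Matrix.ext fun a b => smoothRing_ext fun v => ?_
    have h := hsol v v.2 a b
    rw [hm.rep_ricci a b v, hx a v, hx b v, hg a v, hg b v, hm.rep_symCovDeriv hx a b v,
      show hessian G f a b v = _ from hm.rep_covDeriv hg a b v,
      show G v a b = _ from hm.rep_G a b v] at h
    simp only [Matrix.add_apply, Matrix.sub_apply, Matrix.smul_apply, Matrix.vecMulVec_apply,
      smul_eq_mul, map_add, map_sub, map_mul, map_pow, ev_half, hL, ← hpF v, h]
    simp only [MetricRing.hess]
    have := hf0 v v.2
    field_simp
  have key := congrArg (ev u) (hm.metricRing.horizon_identity (lam := L) hfp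
    (fun a => Derivation.map_algebraMap _ _) hE)
  have hω (a : Fin n) : Rep (fun v => symCovDerivContract G K a v
          - 1 / 2 * K a v * laplacian G f v - 1 / 2 * K a v * divergence G K v
          - lam * f v * K a v) (∑ b, ∑ c, hm.metricRing.H b c * x c * hm.metricRing.sym1 x a b
        - MetricRing.half _ * x a * hm.metricRing.tr (hm.metricRing.hess F)
        - MetricRing.half _ * x a * hm.metricRing.tr (hm.metricRing.cov1 x) - L * F * x a) :=
      fun v => by
    simp only [symCovDerivContract, map_sub, map_sum, map_mul, hm.inv_apply_eq_ev,
      ev_half, hL, hF v, hlap v, hdiv v, fun a => hx a v,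
      fun a b => hm.rep_symCovDeriv hx a b v]
  have hω' := hm.rep_divergence hω u
  rw [map_add, ← hω'] at key
  simp only [map_add, map_sum, map_mul, map_neg, ev_half, hL, ← hF u, ← hlap u,
    ← hdiv u, ← hm.inv_apply_eq_ev, ← hpF u,
    ← hm.rep_symCovDeriv hx _ _ u, ← hm.rep_covDeriv hx _ _ u,
    ← hm.rep_pairing hx hx u, ← hm.rep_pairing hx hg u] at key
  have e : 1 / (2 * f u) = 1 / 2 * (f u)⁻¹ := by rw [one_div, mul_inv, one_div]
  rw [symCovDerivSq, key, e]

end IsMetricOn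

end Bridge

/-! ### Components in a chart -/

section Chart

variable {n : ℕ} {M : Type*} [TopologicalSpace M] [ChartedSpace (EuclideanSpace ℝ (Fin n)) M]
  {φ : OpenPartialHomeomorph M (EuclideanSpace ℝ (Fin n))}

lemma linearIndependent_coordVec (hφ : φ ∈ IsManifold.maximalAtlas (𝓡 n) ∞ M)
    {u : EuclideanSpace ℝ (Fin n)} (hu : u ∈ φ.target) :
    LinearIndependent ℝ fun a => coordVec φ a u := by
  refine Fintype.linearIndependent_iff.2 fun v hv b => ?_
  have hd : φ.MDifferentiable (𝓡 n) (𝓡 n) :=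
    ⟨(contMDiffOn_of_mem_maximalAtlas hφ).mdifferentiableOn (by simp),
     (contMDiffOn_symm_of_mem_maximalAtlas hφ).mdifferentiableOn (by simp)⟩
  have hinj := hd.symm.mfderiv_injective (x := u) hu
  have h : mfderiv (𝓡 n) (𝓡 n) φ.symm u
      (∑ a, v a • EuclideanSpace.single a (1 : ℝ) : EuclideanSpace ℝ (Fin n)) = 0 := by
    rw [← hv]
    exact (map_sum (mfderiv (𝓡 n) (𝓡 n) φ.symm u) _ _).trans
      (Finset.sum_congr rfl fun a _ => map_smul (mfderiv (𝓡 n) (𝓡 n) φ.symm u) _ _)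
  have h0 : (∑ a, v a • EuclideanSpace.single a (1 : ℝ) : EuclideanSpace ℝ (Fin n)) = 0 :=
    hinj (h.trans (map_zero (mfderiv (𝓡 n) (𝓡 n) φ.symm u)).symm)
  have := congrArg (fun w : EuclideanSpace ℝ (Fin n) => w b) h0
  simpa [Finset.sum_apply, Pi.single_apply] using this

variable [IsManifold (𝓡 n) ∞ M]

lemma contMDiffOn_coordVec (hφ : φ ∈ IsManifold.maximalAtlas (𝓡 n) ∞ M) (a : Fin n) :
    ContMDiffOn 𝓘(ℝ, EuclideanSpace ℝ (Fin n)) (𝓡 n).tangent ∞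
      (fun u => (⟨φ.symm u, coordVec φ a u⟩ : TangentBundle (𝓡 n) M)) φ.target := by
  have h := (contMDiffOn_symm_of_mem_maximalAtlas hφ).contMDiffOn_tangentMapWithin
    (m := ∞) (by simp) φ.open_target.uniqueMDiffOn
  have hs : ContMDiff 𝓘(ℝ, EuclideanSpace ℝ (Fin n)) (𝓡 n).tangent ∞
      (fun u => (⟨u, EuclideanSpace.single a (1 : ℝ)⟩ :
        TangentBundle (𝓡 n) (EuclideanSpace ℝ (Fin n)))) := by
    rw [contMDiff_vectorSpace_iff_contDiff (V := fun _ => EuclideanSpace.single a (1 : ℝ))]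
    exact contDiff_const
  refine (h.comp hs.contMDiffOn (s := φ.target) fun u hu => hu).congr fun u hu => ?_
  simp only [Function.comp, tangentMapWithin, coordVec]
  rw [mfderivWithin_of_isOpen φ.open_target hu]

variable (g : Bundle.ContMDiffRiemannianMetric (𝓡 n) ∞ (EuclideanSpace ℝ (Fin n))
      (TangentSpace (𝓡 n) : M → Type _))

lemma contDiffOn_inner (hφ : φ ∈ IsManifold.maximalAtlas (𝓡 n) ∞ M)
    {V W : ∀ u : EuclideanSpace ℝ (Fin n), TangentSpace (𝓡 n) (φ.symm u)}
    (hV : ContMDiffOn 𝓘(ℝ, EuclideanSpace ℝ (Fin n)) (𝓡 n).tangent ∞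
      (fun u => (⟨φ.symm u, V u⟩ : TangentBundle (𝓡 n) M)) φ.target)
    (hW : ContMDiffOn 𝓘(ℝ, EuclideanSpace ℝ (Fin n)) (𝓡 n).tangent ∞
      (fun u => (⟨φ.symm u, W u⟩ : TangentBundle (𝓡 n) M)) φ.target) :
    ContDiffOn ℝ ∞ (fun u => g.inner (φ.symm u) (V u) (W u)) φ.target := by
  have hg := g.contMDiff.comp_contMDiffOn (contMDiffOn_symm_of_mem_maximalAtlas hφ)
  have h : ContMDiffOn 𝓘(ℝ, EuclideanSpace ℝ (Fin n)) ((𝓡 n).prod 𝓘(ℝ, ℝ)) ∞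
      (fun u => (⟨φ.symm u, g.inner (φ.symm u) (V u) (W u)⟩ :
        Bundle.TotalSpace ℝ (Bundle.Trivial M ℝ))) φ.target :=
    ContMDiffOn.clm_bundle_apply₂ (F₁ := EuclideanSpace ℝ (Fin n))
      (F₂ := EuclideanSpace ℝ (Fin n)) hg hV hW
  intro u hu
  have := Bundle.contMDiffWithinAt_totalSpace.1 (h u hu)
  exact this.2.contDiffWithinAt

lemma isMetricOn_metricComp (hφ : φ ∈ IsManifold.maximalAtlas (𝓡 n) ∞ M) :
    IsMetricOn (metricComp g φ) φ.target where
  isOpen := φ.open_target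
  contDiffOn a b :=
    contDiffOn_inner g hφ (contMDiffOn_coordVec hφ a) (contMDiffOn_coordVec hφ b)
  symm u _ a b := g.symm _ _ _
  det_ne_zero u hu hdet := by
    -- A null vector `v` of the matrix would give a vector `w = v^a ∂_a ≠ 0` with `g(w, w) = 0`.
    obtain ⟨v, hv0, hv⟩ := Matrix.exists_mulVec_eq_zero_iff.2 hdet
    refine hv0 (funext (Fintype.linearIndependent_iff.1 (linearIndependent_coordVec hφ hu) v ?_))
    by_contra hw
    refine (g.pos _ _ hw).ne' ?_
    have h2 : v ⬝ᵥ (metricComp g φ u).mulVec v = 0 := by rw [hv, dotProduct_zero]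
    rw [← h2]
    simp only [map_sum, map_smul, sum_apply, smul_apply,
      dotProduct, Matrix.mulVec, metricComp, Matrix.of_apply, smul_eq_mul]
    exact Finset.sum_congr rfl fun a _ => congrArg (v a * ·) (Finset.sum_congr rfl fun b _ => by
      rw [g.symm, mul_comm])

end Chart

end

end HorizonIdentity

open HorizonIdentity in
theorem proposition2p1 {n : ℕ} {M : Type*} [TopologicalSpace M]
    [ChartedSpace (EuclideanSpace ℝ (Fin n)) M] [IsManifold (𝓡 n) ∞ M]
    (g : Bundle.ContMDiffRiemannianMetric (𝓡 n) ∞ (EuclideanSpace ℝ (Fin n))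
      (TangentSpace (𝓡 n) : M → Type _))
    (lam : ℝ)
    (Γ : M → ℝ) (hΓ : ContMDiff (𝓡 n) 𝓘(ℝ, ℝ) ∞ Γ) (hΓpos : ∀ x, 0 < Γ x)
    (K : ∀ x : M, TangentSpace (𝓡 n) x)
    (hK : ContMDiff (𝓡 n) (𝓡 n).tangent ∞ (fun x => (⟨x, K x⟩ : TangentBundle (𝓡 n) M)))
    (hsol : ∀ φ ∈ IsManifold.maximalAtlas (𝓡 n) ∞ M, ∀ u ∈ φ.target,
      HorizonEquationAt (metricComp g φ) (lowerComp g K φ) (Γ ∘ φ.symm) lam u) :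
    ∀ φ ∈ IsManifold.maximalAtlas (𝓡 n) ∞ M, ∀ u ∈ φ.target,
      symCovDerivSq (metricComp g φ) (lowerComp g K φ) u
        = divergence (metricComp g φ)
            (fun a v => symCovDerivContract (metricComp g φ) (lowerComp g K φ) a v
              - 1 / 2 * lowerComp g K φ a v * laplacian (metricComp g φ) (Γ ∘ φ.symm) v
              - 1 / 2 * lowerComp g K φ a v * divergence (metricComp g φ) (lowerComp g K φ) v
              - lam * Γ (φ.symm v) * lowerComp g K φ a v) u
          + divergence (metricComp g φ) (lowerComp g K φ) u *
            (-(1 / (2 * Γ (φ.symm u)))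
                * pairing (metricComp g φ) (lowerComp g K φ) (lowerComp g K φ) u
              + 1 / 2 * laplacian (metricComp g φ) (Γ ∘ φ.symm) u
              + 1 / 2 * divergence (metricComp g φ) (lowerComp g K φ) u
              + 1 / (2 * Γ (φ.symm u))
                * pairing (metricComp g φ) (lowerComp g K φ) (grad (Γ ∘ φ.symm)) u
              + lam * Γ (φ.symm u)) := by
  intro φ hφ u hu
  refine (isMetricOn_metricComp g hφ).coordinate_identity (fun a => ?_) ?_
    (fun v _ => (hΓpos _).ne') (hsol φ hφ) hu
  · exact contDiffOn_inner g hφ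
      (hK.comp_contMDiffOn (contMDiffOn_symm_of_mem_maximalAtlas hφ)) (contMDiffOn_coordVec hφ a)
  · exact contMDiffOn_iff_contDiffOn.1
      (hΓ.comp_contMDiffOn (contMDiffOn_symm_of_mem_maximalAtlas hφ))
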